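/- Let $k$ be an algebraically closed field of characteristic zero and let $m,n\ge 2$ be integers. Let $G_{m,n}=k\{X_1,\dots,X_m\}$ be the ring of generic matrices, i.e. the $k$-subalgebra generated by the $m$ generic $n\times n$ matrices $X_l=(x^{(l)}_{ij})$ inside $\mathrm{M}_n\bigl(k[x^{(l)}_{ij} : 1\le l\le m,\ 1\le i,j\le n]\bigr)$, and let $UD(m,n)$ be the universal division algebra, i.e. the localization of $G_{m,n}$ at its nonzero central elements. Let $\rho$ be the involution of $UD(m,n)$ extending the $k$-linear involution of $G_{m,n}$ that reverses monomials, $\rho(X_{i_1}X_{i_2}\cdots X_{i_j})=X_{i_j}\cdots X_{i_2}X_{i_1}$ (equivalently, $\rho(p)(a)=p(a^t)^t$ for $p\in G_{m,n}$ and $a\in \mathrm{M}_n(k)^m$). Recall that an involution is of the first kind if it restricts to the identity on the center. Let $\tau$ be the automorphism $\tau(h)=(h^{-1})^t$ of $\mathrm{PGL}_n(k)$, let $\langle\tau\rangle$ be the group of order two acting on $\mathrm{PGL}_n(k)$ through $\tau$, and let $P_{n,\tau}=\mathrm{PGL}_n(k)\rtimes\langle\tau\rangle$ act on the affine space $\mathrm{M}_n(k)^m$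 of $m$-tuples of matrices, $\mathrm{PGL}_n(k)$ by simultaneous conjugation and $\tau$ by simultaneous transposition. The action is called generically free if all points of some nonempty (equivalently, dense) Zariski-open subset have trivial stabilizer. Then: 1. the involution $\rho$ of $UD(m,n)$ is of the first kind if and only if $m=n=2$; 2. the action of $P_{n,\tau}$ on $\mathrm{M}_n(k)^m$ is generically free if and only if $(m,n)\ne(2,2)$. -/

import Mathlib

open scoped MatrixGroups

/-! ## Involutions of algebras -/

/-- A `k`-linear involution of a `k`-algebra `A`: a `k`-linear map reversing products, of
order at most two. -/
structure AlgInvolution (k A : Type*) [CommRing k] [Ring A] [Algebra k A]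
    extends A →ₗ[k] A where
  map_mul_rev' : ∀ a b : A, toFun (a * b) = toFun b * toFun a
  involutive' : ∀ a : A, toFun (toFun a) = a

/-- An involution is of the first kind if it restricts to the identity on the center. -/
def AlgInvolution.IsFirstKind {k A : Type*} [CommRing k] [Ring A] [Algebra k A]
    (σ : AlgInvolution k A) : Prop :=
  ∀ z ∈ Subalgebra.center k A, σ.toLinearMap z = z

/-! ## The generic matrix ring and the universal division algebra -/

/-- The polynomial ring over `k` in the `m * n * n` entries of `m` generic `n × n` matrices. -/
abbrev GenericEntryRing (k : Type*) [Field k] (m n : ℕ) : Type _ :=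
  MvPolynomial (Fin m × Fin n × Fin n) k

/-- The `l`-th generic `n × n` matrix. -/
noncomputable def genericMatrix (k : Type*) [Field k] (m n : ℕ) (l : Fin m) :
    Matrix (Fin n) (Fin n) (GenericEntryRing k m n) :=
  Matrix.of fun i j => MvPolynomial.X (l, i, j)

/-- The generic matrix ring: the `k`-subalgebra generated by `m` generic `n × n` matrices. -/
noncomputable def genericMatrixRing (k : Type*) [Field k] (m n : ℕ) :
    Subalgebra k (Matrix (Fin n) (Fin n) (GenericEntryRing k m n)) :=
  Algebra.adjoin k (Set.range (genericMatrix k m n))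

/-- The generic matrices as elements of the generic matrix ring. -/
noncomputable def genX (k : Type*) [Field k] (m n : ℕ) (l : Fin m) : genericMatrixRing k m n :=
  ⟨genericMatrix k m n l, Algebra.subset_adjoin ⟨l, rfl⟩⟩

/-- The `k`-algebra automorphism of the polynomial ring given by transposing all generic
matrices. -/
noncomputable def transposeEntries (k : Type*) [Field k] (m n : ℕ) :
    GenericEntryRing k m n →ₐ[k] GenericEntryRing k m n :=
  MvPolynomial.rename fun q => (q.1, q.2.2, q.2.1)

theorem transposeEntries_transposeEntries (k : Type*) [Field k] (m n : ℕ)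
    (f : GenericEntryRing k m n) :
    transposeEntries k m n (transposeEntries k m n f) = f := by
  unfold transposeEntries
  rw [MvPolynomial.rename_rename]
  exact MvPolynomial.rename_id_apply f

/-- The map `p ↦ (x ↦ p(xᵗ)ᵗ)` on polynomial maps from `m`-tuples of matrices to matrices. -/
noncomputable def rhoMatrix (k : Type*) [Field k] (m n : ℕ) :
    Matrix (Fin n) (Fin n) (GenericEntryRing k m n) →ₗ[k]
      Matrix (Fin n) (Fin n) (GenericEntryRing k m n) where
  toFun A := (A.map (transposeEntries k m n)).transpose
  map_add' A B := by ext i j; simp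
  map_smul' c A := by ext i j; simp

theorem rhoMatrix_mul (k : Type*) [Field k] (m n : ℕ)
    (A B : Matrix (Fin n) (Fin n) (GenericEntryRing k m n)) :
    rhoMatrix k m n (A * B) = rhoMatrix k m n B * rhoMatrix k m n A := by
  simp [rhoMatrix, Matrix.map_mul, Matrix.transpose_mul]

theorem rhoMatrix_rhoMatrix (k : Type*) [Field k] (m n : ℕ)
    (A : Matrix (Fin n) (Fin n) (GenericEntryRing k m n)) :
    rhoMatrix k m n (rhoMatrix k m n A) = A := by
  ext i j : 2
  simp [rhoMatrix, transposeEntries_transposeEntries]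

theorem rhoMatrix_algebraMap (k : Type*) [Field k] (m n : ℕ) (c : k) :
    rhoMatrix k m n (algebraMap k _ c) = algebraMap k _ c := by
  ext i j : 2
  simp only [rhoMatrix, LinearMap.coe_mk, AddHom.coe_mk, Matrix.transpose_apply,
    Matrix.map_apply, Matrix.algebraMap_matrix_apply]
  by_cases h : i = j
  · simp [h]
  · simp [h, Ne.symm h]

theorem rhoMatrix_genericMatrix (k : Type*) [Field k] (m n : ℕ) (l : Fin m) :
    rhoMatrix k m n (genericMatrix k m n l) = genericMatrix k m n l := by
  ext i j : 2
  simp [rhoMatrix, genericMatrix, transposeEntries]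

theorem rhoMatrix_mem (k : Type*) [Field k] (m n : ℕ) :
    ∀ A ∈ Subalgebra.toSubmodule (genericMatrixRing k m n),
      rhoMatrix k m n A ∈ Subalgebra.toSubmodule (genericMatrixRing k m n) := by
  intro A hA
  rw [Subalgebra.mem_toSubmodule] at hA ⊢
  unfold genericMatrixRing at hA ⊢
  induction hA using Algebra.adjoin_induction with
  | mem x hx =>
    obtain ⟨l, rfl⟩ := hx
    rw [rhoMatrix_genericMatrix]
    exact Algebra.subset_adjoin ⟨l, rfl⟩
  | algebraMap c =>
    rw [rhoMatrix_algebraMap]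
    exact Subalgebra.algebraMap_mem _ c
  | add x y _ _ hx hy => rw [map_add]; exact add_mem hx hy
  | mul x y _ _ hx hy => rw [rhoMatrix_mul]; exact mul_mem hy hx

/-- The involution `ρ` of the generic matrix ring. By `rhoGeneric_word` it is the `k`-linear map
reversing every monomial in the generic matrices. -/
noncomputable def rhoGeneric (k : Type*) [Field k] (m n : ℕ) :
    AlgInvolution k (genericMatrixRing k m n) where
  toLinearMap := (rhoMatrix k m n).restrict (rhoMatrix_mem k m n)
  map_mul_rev' a b := Subtype.ext (rhoMatrix_mul k m n a b)
  involutive' a := Subtype.ext (rhoMatrix_rhoMatrix k m n a)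

theorem rhoGeneric_one (k : Type*) [Field k] (m n : ℕ) :
    (rhoGeneric k m n).toLinearMap 1 = 1 := by
  apply Subtype.ext
  have h := rhoMatrix_algebraMap k m n 1
  rw [map_one] at h
  exact h

theorem rhoGeneric_mul (k : Type*) [Field k] (m n : ℕ) (a b : genericMatrixRing k m n) :
    (rhoGeneric k m n).toLinearMap (a * b) =
      (rhoGeneric k m n).toLinearMap b * (rhoGeneric k m n).toLinearMap a :=
  (rhoGeneric k m n).map_mul_rev' a b

theorem rhoGeneric_rhoGeneric (k : Type*) [Field k] (m n : ℕ) (a : genericMatrixRing k m n) :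
    (rhoGeneric k m n).toLinearMap ((rhoGeneric k m n).toLinearMap a) = a :=
  (rhoGeneric k m n).involutive' a

/-- `ρ (X_{i₁} X_{i₂} ⋯ X_{iⱼ}) = X_{iⱼ} ⋯ X_{i₂} X_{i₁}`. -/
theorem rhoGeneric_word (k : Type*) [Field k] (m n : ℕ) (w : List (Fin m)) :
    (rhoGeneric k m n).toLinearMap ((w.map (genX k m n)).prod) =
      (w.reverse.map (genX k m n)).prod := by
  induction w with
  | nil => simpa using rhoGeneric_one k m n
  | cons l w ih =>
    have h : (rhoGeneric k m n).toLinearMap (genX k m n l) = genX k m n l :=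
      Subtype.ext (rhoMatrix_genericMatrix k m n l)
    rw [List.map_cons, List.prod_cons, rhoGeneric_mul, ih, h]
    simp

/-- The multiplicative set generated by the nonzero central elements of the generic matrix
ring. (For `n ≥ 1` the generic matrix ring has no zero divisors, so this is just the set of all
nonzero central elements.) -/
noncomputable def centralDenominators (k : Type*) [Field k] (m n : ℕ) :
    Submonoid (genericMatrixRing k m n) :=
  Submonoid.closure {s | s ∈ Set.center (genericMatrixRing k m n) ∧ s ≠ 0}

theorem centralDenominators_comm (k : Type*) [Field k] (m n : ℕ)
    (s : centralDenominators k m n) (r : genericMatrixRing k m n) :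
    (s : genericMatrixRing k m n) * r = r * s := by
  have h : centralDenominators k m n ≤ Submonoid.center (genericMatrixRing k m n) :=
    Submonoid.closure_le.2 fun _ hs => hs.1
  exact (Submonoid.mem_center_iff.1 (h s.2) r).symm

noncomputable instance centralDenominators.oreSet (k : Type*) [Field k] (m n : ℕ) :
    OreLocalization.OreSet (centralDenominators k m n) where
  ore_right_cancel r₁ r₂ s h := ⟨s, by
    rw [centralDenominators_comm, centralDenominators_comm, h]⟩
  oreNum r _ := r
  oreDenom _ s := s
  ore_eq r s := centralDenominators_comm k m n s r

/-- The universal division algebra `UD(m,n)`: the localization of the generic matrix ring at its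
nonzero central elements. -/
abbrev UniversalDivisionAlgebra (k : Type*) [Field k] (m n : ℕ) : Type _ :=
  OreLocalization (centralDenominators k m n) (genericMatrixRing k m n)

/-- The canonical map from the generic matrix ring to the universal division algebra. -/
noncomputable abbrev toUD (k : Type*) [Field k] (m n : ℕ) :
    genericMatrixRing k m n →+* UniversalDivisionAlgebra k m n :=
  OreLocalization.numeratorRingHom

theorem isUnit_toUD (k : Type*) [Field k] (m n : ℕ) (s : centralDenominators k m n) :
    IsUnit (toUD k m n s) :=
  OreLocalization.numerator_isUnit s

theorem rhoGeneric_mem_centralDenominators (k : Type*) [Field k] (m n : ℕ)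
    {s : genericMatrixRing k m n} (hs : s ∈ centralDenominators k m n) :
    (rhoGeneric k m n).toLinearMap s ∈ centralDenominators k m n := by
  unfold centralDenominators at hs ⊢
  induction hs using Submonoid.closure_induction with
  | mem x hx =>
    refine Submonoid.subset_closure ⟨?_, ?_⟩
    · rw [Semigroup.mem_center_iff]
      intro g
      have h := Semigroup.mem_center_iff.1 hx.1 ((rhoGeneric k m n).toLinearMap g)
      have h' := congrArg (rhoGeneric k m n).toLinearMap h
      rw [rhoGeneric_mul, rhoGeneric_mul, rhoGeneric_rhoGeneric] at h'
      exact h'.symm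
    · intro h
      apply hx.2
      rw [← rhoGeneric_rhoGeneric k m n x, h, map_zero]
  | one => rw [rhoGeneric_one]; exact one_mem _
  | mul x y _ _ hx hy => rw [rhoGeneric_mul]; exact mul_mem hy hx

/-- `p ↦ ρ(p)` as a ring homomorphism into the opposite ring of the universal division algebra. -/
noncomputable def rhoToOp (k : Type*) [Field k] (m n : ℕ) :
    genericMatrixRing k m n →+* (UniversalDivisionAlgebra k m n)ᵐᵒᵖ where
  toFun p := MulOpposite.op (toUD k m n ((rhoGeneric k m n).toLinearMap p))
  map_one' := by rw [rhoGeneric_one, map_one]; rfl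
  map_mul' a b := by rw [rhoGeneric_mul, map_mul]; rfl
  map_zero' := by rw [map_zero, map_zero]; rfl
  map_add' a b := by rw [map_add, map_add]; rfl

theorem isUnit_rhoToOp (k : Type*) [Field k] (m n : ℕ) (s : centralDenominators k m n) :
    IsUnit ((rhoToOp k m n).toMonoidHom.comp (centralDenominators k m n).subtype s) :=
  IsUnit.op (isUnit_toUD k m n ⟨_, rhoGeneric_mem_centralDenominators k m n s.2⟩)

/-- The extension of `rhoToOp` to the universal division algebra. -/
noncomputable def rhoOp (k : Type*) [Field k] (m n : ℕ) :
    UniversalDivisionAlgebra k m n →+* (UniversalDivisionAlgebra k m n)ᵐᵒᵖ :=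
  OreLocalization.universalHom (rhoToOp k m n)
    (IsUnit.liftRight _ (isUnit_rhoToOp k m n)) (fun _ => rfl)

theorem rhoOp_toUD (k : Type*) [Field k] (m n : ℕ) (p : genericMatrixRing k m n) :
    rhoOp k m n (toUD k m n p) =
      MulOpposite.op (toUD k m n ((rhoGeneric k m n).toLinearMap p)) :=
  OreLocalization.universalHom_commutes (f := rhoToOp k m n)
    (fS := IsUnit.liftRight _ (isUnit_rhoToOp k m n)) (hf := fun _ => rfl)

theorem rhoOp_rhoOp (k : Type*) [Field k] (m n : ℕ) (x : UniversalDivisionAlgebra k m n) :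
    (rhoOp k m n (rhoOp k m n x).unop).unop = x := by
  induction x using OreLocalization.ind with
  | _ r s =>
    have hx : toUD k m n s * (OreLocalization.oreDiv r s) = toUD k m n r :=
      OreLocalization.mul_cancel
    have h2 (p : genericMatrixRing k m n) :
        (rhoOp k m n (rhoOp k m n (toUD k m n p)).unop).unop = toUD k m n p := by
      rw [rhoOp_toUD, MulOpposite.unop_op, rhoOp_toUD, MulOpposite.unop_op,
        rhoGeneric_rhoGeneric]
    apply (isUnit_toUD k m n s).mul_left_cancel
    have h := h2 r
    rw [← hx, map_mul, MulOpposite.unop_mul, map_mul, MulOpposite.unop_mul, h2 s] at h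
    exact h

/-- The involution `ρ` of the universal division algebra: the extension of the involution `ρ` of
the generic matrix ring (see `rhoUD_toUD`). -/
noncomputable def rhoUD (k : Type*) [Field k] (m n : ℕ) :
    AlgInvolution k (UniversalDivisionAlgebra k m n) where
  toFun x := (rhoOp k m n x).unop
  map_add' x y := by rw [map_add, MulOpposite.unop_add]
  map_smul' c x := by
    have hc : rhoOp k m n (algebraMap k _ c) = MulOpposite.op (algebraMap k _ c) := by
      have h : (rhoGeneric k m n).toLinearMap (algebraMap k _ c) = algebraMap k _ c :=
        Subtype.ext (rhoMatrix_algebraMap k m n c)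
      change rhoOp k m n (toUD k m n (algebraMap k _ c)) = _
      rw [rhoOp_toUD, h]
      rfl
    rw [Algebra.smul_def, map_mul, hc, MulOpposite.unop_mul, MulOpposite.unop_op,
      RingHom.id_apply, Algebra.smul_def, Algebra.commutes]
  map_mul_rev' a b := by
    change (rhoOp k m n (a * b)).unop = (rhoOp k m n b).unop * (rhoOp k m n a).unop
    rw [map_mul, MulOpposite.unop_mul]
  involutive' a := rhoOp_rhoOp k m n a

theorem rhoUD_toUD (k : Type*) [Field k] (m n : ℕ) (p : genericMatrixRing k m n) :
    (rhoUD k m n).toLinearMap (toUD k m n p) =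
      toUD k m n ((rhoGeneric k m n).toLinearMap p) :=
  congrArg MulOpposite.unop (rhoOp_toUD k m n p)

/-! ## The group `PGLₙ ⋊ ⟨τ⟩` and its action on tuples of matrices -/

/-- The homomorphism from the group of order two sending the generator to a given element `x`
with `x * x = 1`. -/
def homOfMulSelf {P : Type*} [Group P] (x : P) (hx : x * x = 1) :
    Multiplicative (ZMod 2) →* P where
  toFun e := if e = 1 then 1 else x
  map_one' := if_pos rfl
  map_mul' a b := by
    have h : ∀ a : Multiplicative (ZMod 2), a = 1 ∨ a = Multiplicative.ofAdd 1 := by decide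
    have h1 : (Multiplicative.ofAdd 1 : Multiplicative (ZMod 2)) ≠ 1 := by decide
    have h2 : (Multiplicative.ofAdd 1 * Multiplicative.ofAdd 1 :
      Multiplicative (ZMod 2)) = 1 := by decide
    rcases h a with rfl | rfl <;> rcases h b with rfl | rfl <;> simp [h1, h2, hx]

/-- `g ↦ (g⁻¹)ᵗ` on `GLₙ`. -/
def tauGL (k : Type*) [Field k] (n : ℕ) : GL (Fin n) k →* GL (Fin n) k where
  toFun g := ⟨(↑g⁻¹ : Matrix (Fin n) (Fin n) k).transpose,
    (↑g : Matrix (Fin n) (Fin n) k).transpose,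
    by rw [← Matrix.transpose_mul, ← Units.val_mul, mul_inv_cancel, Units.val_one,
      Matrix.transpose_one],
    by rw [← Matrix.transpose_mul, ← Units.val_mul, inv_mul_cancel, Units.val_one,
      Matrix.transpose_one]⟩
  map_one' := by ext1; simp
  map_mul' g h := by
    ext1
    change (↑(g * h)⁻¹ : Matrix (Fin n) (Fin n) k).transpose =
      (↑g⁻¹ : Matrix (Fin n) (Fin n) k).transpose * (↑h⁻¹ : Matrix (Fin n) (Fin n) k).transpose
    rw [mul_inv_rev, Units.val_mul, Matrix.transpose_mul]

theorem tauGL_tauGL (k : Type*) [Field k] (n : ℕ) (g : GL (Fin n) k) :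
    tauGL k n (tauGL k n g) = g := by
  ext1
  change (↑((tauGL k n g)⁻¹) : Matrix (Fin n) (Fin n) k).transpose = ↑g
  change ((↑g : Matrix (Fin n) (Fin n) k).transpose).transpose = ↑g
  exact Matrix.transpose_transpose _

/-- The endomorphism of `PGLₙ` induced by `g ↦ (g⁻¹)ᵗ`. -/
def tauPGL (k : Type*) [Field k] (n : ℕ) :
    Matrix.ProjGenLinGroup (Fin n) k →* Matrix.ProjGenLinGroup (Fin n) k :=
  Matrix.ProjGenLinGroup.lift (Matrix.ProjGenLinGroup.mk.comp (tauGL k n)) (by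
    ext u
    have h : tauGL k n (Matrix.GeneralLinearGroup.scalar (Fin n) u) =
        Matrix.GeneralLinearGroup.scalar (Fin n) u⁻¹ := by
      ext1
      change (↑(Matrix.GeneralLinearGroup.scalar (Fin n) u)⁻¹ :
        Matrix (Fin n) (Fin n) k).transpose = _
      rw [← map_inv, Matrix.GeneralLinearGroup.coe_scalar, Matrix.scalar_apply,
        Matrix.diagonal_transpose]
    simp [h])

theorem tauPGL_mk (k : Type*) [Field k] (n : ℕ) (g : GL (Fin n) k) :
    tauPGL k n (Matrix.ProjGenLinGroup.mk g) = Matrix.ProjGenLinGroup.mk (tauGL k n g) := rfl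

theorem tauPGL_comp (k : Type*) [Field k] (n : ℕ) :
    (tauPGL k n).comp (tauPGL k n) = MonoidHom.id _ := by
  ext g
  induction g using Matrix.ProjGenLinGroup.induction_on with
  | mk g => simp [tauPGL_mk, tauGL_tauGL]

/-- The automorphism `τ(h) = (h⁻¹)ᵗ` of `PGLₙ`. -/
def tauAut (k : Type*) [Field k] (n : ℕ) : MulAut (Matrix.ProjGenLinGroup (Fin n) k) :=
  MonoidHom.toMulEquiv (tauPGL k n) (tauPGL k n) (tauPGL_comp k n) (tauPGL_comp k n)

theorem tauAut_mul_self (k : Type*) [Field k] (n : ℕ) : tauAut k n * tauAut k n = 1 := by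
  ext g
  exact DFunLike.congr_fun (tauPGL_comp k n) g

/-- The semidirect product `PGLₙ ⋊ ⟨τ⟩`, where `⟨τ⟩` is the group of order two (written here as
`Multiplicative (ZMod 2)`) whose generator acts by `τ(h) = (h⁻¹)ᵗ`. -/
abbrev PGLTau (k : Type*) [Field k] (n : ℕ) : Type _ :=
  SemidirectProduct (Matrix.ProjGenLinGroup (Fin n) k) (Multiplicative (ZMod 2))
    (homOfMulSelf (tauAut k n) (tauAut_mul_self k n))

/-- `GLₙ` acting on `n × n` matrices by conjugation. -/
def conjGL (k : Type*) [Field k] (n : ℕ) :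
    GL (Fin n) k →* Equiv.Perm (Matrix (Fin n) (Fin n) k) where
  toFun g :=
    { toFun := fun a => (↑g : Matrix (Fin n) (Fin n) k) * a * (↑g⁻¹ : Matrix (Fin n) (Fin n) k)
      invFun := fun a => (↑g⁻¹ : Matrix (Fin n) (Fin n) k) * a * (↑g : Matrix (Fin n) (Fin n) k)
      left_inv := fun a => by simp only [mul_assoc, Units.inv_mul, Units.inv_mul_cancel_left,
        mul_one]
      right_inv := fun a => by simp only [mul_assoc, Units.mul_inv, Units.mul_inv_cancel_left,
        mul_one] }
  map_one' := by ext1 a; simp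
  map_mul' g h := by ext1 a; simp only [mul_inv_rev, Units.val_mul, Equiv.Perm.coe_mul,
    Function.comp_apply, Equiv.coe_fn_mk, mul_assoc]

/-- `PGLₙ` acting on `n × n` matrices by conjugation. -/
def conjPGL (k : Type*) [Field k] (n : ℕ) :
    Matrix.ProjGenLinGroup (Fin n) k →* Equiv.Perm (Matrix (Fin n) (Fin n) k) :=
  Matrix.ProjGenLinGroup.lift (conjGL k n) (by
    ext1 u
    ext1 a
    change (↑(Matrix.GeneralLinearGroup.scalar (Fin n) u) : Matrix (Fin n) (Fin n) k) * a *
      (↑(Matrix.GeneralLinearGroup.scalar (Fin n) u)⁻¹ : Matrix (Fin n) (Fin n) k) = a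
    have h : (↑(Matrix.GeneralLinearGroup.scalar (Fin n) u) : Matrix (Fin n) (Fin n) k) * a =
        a * (↑(Matrix.GeneralLinearGroup.scalar (Fin n) u) : Matrix (Fin n) (Fin n) k) := by
      rw [Matrix.GeneralLinearGroup.coe_scalar]
      exact Matrix.scalar_commute _ (fun _ => Commute.all _ _) a
    rw [h, mul_assoc, Units.mul_inv, mul_one])

/-- Transposition as a permutation of the set of `n × n` matrices. -/
def transposePerm (k : Type*) [Field k] (n : ℕ) : Equiv.Perm (Matrix (Fin n) (Fin n) k) where
  toFun := Matrix.transpose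
  invFun := Matrix.transpose
  left_inv := Matrix.transpose_transpose
  right_inv := Matrix.transpose_transpose

theorem transposePerm_mul_self (k : Type*) [Field k] (n : ℕ) :
    transposePerm k n * transposePerm k n = 1 := by
  ext1 a
  exact Matrix.transpose_transpose a

/-- The action of `PGLₙ ⋊ ⟨τ⟩` on `n × n` matrices: `PGLₙ` acts by conjugation and `τ` by
transposition. -/
def pglTauPerm (k : Type*) [Field k] (n : ℕ) :
    PGLTau k n →* Equiv.Perm (Matrix (Fin n) (Fin n) k) :=
  SemidirectProduct.lift (conjPGL k n)
    (homOfMulSelf (transposePerm k n) (transposePerm_mul_self k n)) (by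
      intro e
      have he : e = 1 ∨ e = Multiplicative.ofAdd 1 := by revert e; decide
      have h1 : (Multiplicative.ofAdd 1 : Multiplicative (ZMod 2)) ≠ 1 := by decide
      rcases he with rfl | rfl
      · ext1 g; simp
      · ext1 g
        induction g using Matrix.ProjGenLinGroup.induction_on with
        | mk g =>
          ext1 a
          have hg : homOfMulSelf (tauAut k n) (tauAut_mul_self k n) (Multiplicative.ofAdd 1) =
            tauAut k n := by simp [homOfMulSelf, h1]
          have ht : homOfMulSelf (transposePerm k n) (transposePerm_mul_self k n)
            (Multiplicative.ofAdd 1) = transposePerm k n := by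
              simp [homOfMulSelf, h1]
          simp only [MonoidHom.comp_apply, hg, ht, MulEquiv.coe_toMonoidHom, MulAut.conj_apply]
          change (↑g⁻¹ : Matrix (Fin n) (Fin n) k).transpose * a *
              (↑g : Matrix (Fin n) (Fin n) k).transpose =
            ((↑g : Matrix (Fin n) (Fin n) k) * a.transpose *
              (↑g⁻¹ : Matrix (Fin n) (Fin n) k)).transpose
          rw [Matrix.transpose_mul, Matrix.transpose_mul, Matrix.transpose_transpose, mul_assoc])

/-- `PGLₙ ⋊ ⟨τ⟩` acts on `n × n` matrices, hence, componentwise, on `m`-tuples of such matrices: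
`PGLₙ` by simultaneous conjugation, `τ` by simultaneous transposition. -/
instance pglTauMulAction (k : Type*) [Field k] (n : ℕ) :
    MulAction (PGLTau k n) (Matrix (Fin n) (Fin n) k) :=
  MulAction.compHom _ (pglTauPerm k n)

/-- Zariski open subsets of the affine space of `m`-tuples of `n × n` matrices. -/
def IsZariskiOpen {k : Type*} [Field k] {m n : ℕ}
    (U : Set (Fin m → Matrix (Fin n) (Fin n) k)) : Prop :=
  ∃ I : Ideal (MvPolynomial (Fin m × Fin n × Fin n) k),
    ∀ x, x ∈ U ↔ (fun q : Fin m × Fin n × Fin n => x q.1 q.2.1 q.2.2) ∉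
      MvPolynomial.zeroLocus k I

/-- The action of `G` on the (irreducible) variety of `m`-tuples of `n × n` matrices is
generically free: points in general position, i.e. all points of some nonempty (equivalently,
dense) Zariski open subset, have trivial stabilizer. -/
def IsGenericallyFree (G k : Type*) [Group G] [Field k] (m n : ℕ)
    [MulAction G (Fin m → Matrix (Fin n) (Fin n) k)] : Prop :=
  ∃ U : Set (Fin m → Matrix (Fin n) (Fin n) k), IsZariskiOpen U ∧ U.Nonempty ∧
    ∀ x ∈ U, MulAction.stabilizer G x = ⊥

/-!
The center of the generic matrix ring consists of scalar matrices, because the words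
`X₀ ^ i X₁ X₀ ^ j` span all matrices over the fraction field (`genericSpanDet_ne_zero`). Hence
nonzero central elements are regular, the ring embeds into its localization, and `ρ` is of the first
kind exactly when it fixes the center of the generic matrix ring (`rhoUD_isFirstKind_iff`). On a
scalar matrix `f`, the involution `ρ` acts by substituting the transposes of the generic matrices
into `f`.

If `(m, n) ≠ (2, 2)`, there is a central element which is not fixed. Formanek's polynomial
`formanek x y` is central: for diagonal `x` with eigenvalues `λᵢ` it equals the scalar
`V(λ)² ∑_σ ∏_j (y_j)_{σ j, σ (j + 1)}` (`formanek_diagonal`), where `σ` runs over all permutations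
and `V` is the Vandermonde determinant, and the generic matrix is diagonalizable over an algebraic
closure of the fraction field. Transposing the variables reverses the cycles `σ 0, σ 1, …`. With
`y_j = e_j(x₀) x₁` or `e_j(x₀) x_last`, where the `e_j` are Lagrange polynomials at the eigenvalues
of the chosen matrix `x₀`, only the identity permutation contributes, and at `asymmetricPoint` the
value is nonzero while it vanishes at the transposed point. This polynomial also separates a general
tuple from the conjugates of its transpose, and thus excludes stabilizer elements outside `PGLₙ`;
those in `PGLₙ` are excluded as the commutant of two general matrices is scalar.

If `(m, n) = (2, 2)`, the matrix `J [A, B]` with `J` skew-symmetric intertwines `A, B` with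
`Aᵗ, Bᵗ` (`transposeIntertwiner`). For generic matrices this shows that scalar elements are
invariant under `ρ`, and at a pair where `[A, B]` is invertible it yields a stabilizer element outside
`PGLₙ`.
-/

/-! ### Formanek's polynomial -/

/-- The noncommutative polynomial obtained from the product `V(t₀, …, t_N) V(t_{N+1}, t₁, …, t_N)`
of two Vandermonde determinants by replacing each monomial `t₀ ^ a₀ ⋯ t_{N+1} ^ a_{N+1}` with
`x ^ a₀ y₀ x ^ a₁ y₁ ⋯ y_N x ^ a_{N+1}`. -/
def formanekTerm {A : Type*} [Ring A] {N : ℕ} (x : A) (y : Fin (N + 1) → A) : A :=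
  ∑ p : Equiv.Perm (Fin (N + 1)), ∑ q : Equiv.Perm (Fin (N + 1)),
    ((Equiv.Perm.sign p : ℤ) * (Equiv.Perm.sign q : ℤ)) •
      ((List.ofFn fun j : Fin (N + 1) =>
        x ^ ((p j : ℕ) + if j = 0 then 0 else (q j : ℕ)) * y j).prod * x ^ (q 0 : ℕ))

/-- Formanek's polynomial for matrices of size `N + 1`: the sum of `formanekTerm` over the cyclic
rotations of the variables `y`. -/
def formanek {A : Type*} [Ring A] {N : ℕ} (x : A) (y : Fin (N + 1) → A) : A :=
  ∑ r : Fin (N + 1), formanekTerm x fun j => y (j + r)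

theorem map_formanek {A B F : Type*} [Ring A] [Ring B] [FunLike F A B] [RingHomClass F A B]
    (f : F) {N : ℕ} (x : A) (y : Fin (N + 1) → A) :
    f (formanek x y) = formanek (f x) (fun j => f (y j)) := by
  simp only [formanek, formanekTerm, map_sum, map_zsmul, map_mul, map_list_prod, List.map_ofFn,
    map_pow, Function.comp_def]

theorem det_vandermonde_eq_sum {R : Type*} [CommRing R] {n : ℕ} (v : Fin n → R) :
    (Matrix.vandermonde v).det =
      ∑ p : Equiv.Perm (Fin n), ((Equiv.Perm.sign p : ℤ) : R) * ∏ j, v j ^ (p j : ℕ) := by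
  rw [← Matrix.det_transpose, Matrix.det_apply']
  simp [Matrix.vandermonde_apply]

/-- A product of matrices as a sum over paths in the index set. -/
theorem list_prod_ofFn_eq_sum_single {R ι : Type*} [CommRing R] [Fintype ι] [DecidableEq ι]
    (m : ℕ) (Z : Fin m → Matrix ι ι R) :
    (List.ofFn Z).prod = ∑ i : Fin (m + 1) → ι,
      (∏ j : Fin m, Z j (i j.castSucc) (i j.succ)) • Matrix.single (i 0) (i (Fin.last m)) 1 := by
  induction m with
  | zero =>
    simp only [List.ofFn_zero, List.prod_nil, Finset.univ_eq_empty, Finset.prod_empty, one_smul]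
    rw [← Matrix.diagonal_one, ← Matrix.sum_single_eq_diagonal]
    exact ((Equiv.funUnique (Fin 1) ι).sum_comp fun r => Matrix.single r r (1 : R)).symm
  | succ m ih =>
    refine Eq.trans ?_ ((Fin.consEquiv fun _ : Fin (m + 2) => ι).sum_comp _)
    rw [List.ofFn_succ, List.prod_cons, ih, Finset.mul_sum, Fintype.sum_prod_type_right]
    refine Finset.sum_congr rfl fun i _ => ?_
    rw [mul_smul_comm]
    have h : Z 0 * Matrix.single (i 0) (i (Fin.last m)) (1 : R) =
        ∑ r, Z 0 r (i 0) • Matrix.single r (i (Fin.last m)) 1 := by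
      ext a b
      simp [Matrix.sum_apply, Matrix.mul_apply, Matrix.single_apply, ite_and]
    rw [h, Finset.smul_sum]
    refine Finset.sum_congr rfl fun r _ => ?_
    rw [smul_smul, Fin.prod_univ_succ]
    simp [Fin.consEquiv, ← Fin.succ_last, mul_comm]

theorem list_prod_diagonal_pow_mul {R : Type*} [CommRing R] {N : ℕ} (l : Fin (N + 1) → R)
    (y : Fin (N + 1) → Matrix (Fin (N + 1)) (Fin (N + 1)) R) (b : Fin (N + 1) → ℕ) (e : ℕ) :
    (List.ofFn fun j => Matrix.diagonal l ^ b j * y j).prod * Matrix.diagonal l ^ e =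
      ∑ i : Fin (N + 2) → Fin (N + 1),
        ((∏ j : Fin (N + 1), l (i j.castSucc) ^ b j) * l (i (Fin.last _)) ^ e *
          ∏ j : Fin (N + 1), y j (i j.castSucc) (i j.succ)) •
          Matrix.single (i 0) (i (Fin.last _)) 1 := by
  rw [list_prod_ofFn_eq_sum_single, Finset.sum_mul]
  refine Finset.sum_congr rfl fun i _ => ?_
  rw [smul_mul_assoc]
  simp only [Matrix.diagonal_pow, Matrix.diagonal_mul, Finset.prod_mul_distrib, Pi.pow_apply]
  have h : Matrix.single (i 0) (i (Fin.last _)) (1 : R) * Matrix.diagonal (l ^ e) =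
      l (i (Fin.last _)) ^ e • Matrix.single (i 0) (i (Fin.last _)) 1 := by
    ext a c
    by_cases h : i (Fin.last _) = c <;> simp [Matrix.mul_diagonal, Matrix.single_apply, h]
  rw [h, smul_smul, mul_right_comm]

/-- The path `σ 0, …, σ N, σ 0`. -/
def closedPath {N : ℕ} (s : Equiv.Perm (Fin (N + 1))) : Fin (N + 2) → Fin (N + 1) :=
  Fin.snoc (α := fun _ => Fin (N + 1)) s (s 0)

theorem closedPath_castSucc {N : ℕ} (s : Equiv.Perm (Fin (N + 1))) (j : Fin (N + 1)) :
    closedPath s j.castSucc = s j := by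
  simp [closedPath]

theorem closedPath_last {N : ℕ} (s : Equiv.Perm (Fin (N + 1))) :
    closedPath s (Fin.last _) = s 0 := by
  simp [closedPath]

theorem closedPath_succ {N : ℕ} (s : Equiv.Perm (Fin (N + 1))) (j : Fin (N + 1)) :
    closedPath s j.succ = s (j + 1) := by
  induction j using Fin.lastCases with
  | last => rw [Fin.succ_last, closedPath_last, Fin.last_add_one]
  | cast j => rw [Fin.succ_castSucc, closedPath_castSucc, Fin.coeSucc_eq_succ]

theorem closedPath_injective {N : ℕ} :
    Function.Injective (closedPath : Equiv.Perm (Fin (N + 1)) → _) := fun s t h =>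
  Equiv.ext fun j => by rw [← closedPath_castSucc, h, closedPath_castSucc]

/-- At a diagonal matrix, `x ^ a₀ y₀ x ^ a₁ ⋯` is a sum over paths in the index set, and the
coefficient of a path is the Vandermonde product evaluated at the eigenvalues along the path. -/
theorem formanekTerm_diagonal {R : Type*} [CommRing R] {N : ℕ} (l : Fin (N + 1) → R)
    (y : Fin (N + 1) → Matrix (Fin (N + 1)) (Fin (N + 1)) R) :
    formanekTerm (Matrix.diagonal l) y = ∑ s : Equiv.Perm (Fin (N + 1)),
      ((Matrix.vandermonde l).det ^ 2 * ∏ j, y j (s j) (s (j + 1))) •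
        Matrix.single (s 0) (s 0) 1 := by
  have key : formanekTerm (Matrix.diagonal l) y = ∑ i : Fin (N + 2) → Fin (N + 1),
      ((Matrix.vandermonde fun j : Fin (N + 1) => l (i j.castSucc)).det *
        (Matrix.vandermonde fun j : Fin (N + 1) =>
          l (if j = 0 then i (Fin.last _) else i j.castSucc)).det *
        ∏ j : Fin (N + 1), y j (i j.castSucc) (i j.succ)) •
          Matrix.single (i 0) (i (Fin.last _)) 1 := by
    simp only [formanekTerm, list_prod_diagonal_pow_mul, det_vandermonde_eq_sum,
      Finset.smul_sum, Finset.mul_sum, Finset.sum_mul, Finset.sum_smul]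
    rw [Finset.sum_congr rfl fun p _ => Finset.sum_comm, Finset.sum_comm]
    refine Finset.sum_congr rfl fun i _ => ?_
    rw [Finset.sum_comm]
    refine Finset.sum_congr rfl fun q _ => Finset.sum_congr rfl fun p _ => ?_
    rw [← Int.cast_smul_eq_zsmul R, smul_smul]
    congr 1
    push_cast
    simp only [pow_add, Finset.prod_mul_distrib]
    rw [Fin.prod_univ_succ (fun j => l (if j = 0 then i (Fin.last _) else i j.castSucc) ^ _),
      Fin.prod_univ_succ (fun j : Fin (N + 1) => l (i j.castSucc) ^ (if j = 0 then 0 else _))]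
    simp only [if_true, pow_zero, one_mul, Fin.succ_ne_zero, if_false]
    ring
  rw [key]
  symm
  -- the Vandermonde determinants vanish on all but the closed paths through all indices
  refine Fintype.sum_of_injective closedPath closedPath_injective _ _ (fun i hi => ?_) fun s => ?_
  · have hdet (c : Fin (N + 1) → Fin (N + 1)) (hc : ¬ Function.Injective c) :
        (Matrix.vandermonde fun j => l (c j)).det = 0 := by
      rw [Function.not_injective_iff] at hc
      obtain ⟨a, b, hab, hne⟩ := hc
      exact Matrix.det_zero_of_row_eq hne (by ext; simp [Matrix.vandermonde_apply, hab])
    by_cases h1 : Function.Injective fun j : Fin (N + 1) => i j.castSucc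
    · by_cases h2 : Function.Injective fun j : Fin (N + 1) =>
          if j = 0 then i (Fin.last _) else i j.castSucc
      · -- two injective families which agree outside `0` have the same value at `0`
        refine absurd ⟨Equiv.ofBijective _ (Finite.injective_iff_bijective.1 h1), ?_⟩ hi
        funext a
        induction a using Fin.lastCases with
        | cast j => rw [closedPath_castSucc]; rfl
        | last =>
          rw [closedPath_last, Equiv.ofBijective_apply]
          obtain ⟨j, hj⟩ := (Finite.injective_iff_bijective.1 h1).2 (i (Fin.last _))
          by_cases h0 : j = 0
          · rw [← hj, h0]
          · exact absurd (@h2 j 0 (by simpa [h0] using hj)) h0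
      · rw [hdet _ h2, mul_zero, zero_mul, zero_smul]
    · rw [hdet _ h1, zero_mul, zero_mul, zero_smul]
  · have h2 : (fun j : Fin (N + 1) =>
        l (if j = 0 then closedPath s (Fin.last _) else closedPath s j.castSucc)) =
        fun j => l (s j) := by
      funext j
      split_ifs with h
      · rw [closedPath_last, h]
      · rw [closedPath_castSucc]
    have h3 : (Matrix.vandermonde fun j => l (s j)).det =
        ((Equiv.Perm.sign s : ℤ) : R) * (Matrix.vandermonde l).det := by
      rw [← Matrix.det_permute]
      rfl
    have h4 : closedPath s 0 = s 0 := by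
      rw [← Fin.castSucc_zero, closedPath_castSucc]
    rw [h2]
    simp only [closedPath_castSucc, closedPath_succ, closedPath_last, h3, h4]
    congr 2
    rw [mul_mul_mul_comm, ← Int.cast_mul, ← Units.val_mul, Int.units_mul_self, Units.val_one,
      Int.cast_one, one_mul, sq]

/-- Formanek's polynomial takes scalar values when its first argument is diagonal. -/
theorem formanek_diagonal {R : Type*} [CommRing R] {N : ℕ} (l : Fin (N + 1) → R)
    (y : Fin (N + 1) → Matrix (Fin (N + 1)) (Fin (N + 1)) R) :
    formanek (Matrix.diagonal l) y = Matrix.scalar (Fin (N + 1))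
      ((Matrix.vandermonde l).det ^ 2 *
        ∑ s : Equiv.Perm (Fin (N + 1)), ∏ j, y j (s j) (s (j + 1))) := by
  have h (r : Fin (N + 1)) : formanekTerm (Matrix.diagonal l) (fun j => y (j + r)) =
      ∑ s : Equiv.Perm (Fin (N + 1)),
        ((Matrix.vandermonde l).det ^ 2 * ∏ j, y j (s j) (s (j + 1))) •
          Matrix.single (s r) (s r) 1 := by
    rw [formanekTerm_diagonal]
    -- rotate the path so that it starts at the old position `r`
    refine Fintype.sum_equiv (Equiv.mulRight (Equiv.addRight (-r))) _ _ fun s => ?_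
    simp only [Equiv.coe_mulRight, Equiv.Perm.mul_apply, Equiv.coe_addRight, add_neg_cancel]
    congr 2
    refine Fintype.prod_equiv (Equiv.addRight r) _ _ fun j => ?_
    simp only [Equiv.coe_addRight]
    congr 2
    · abel
    · abel
  simp only [formanek, h]
  rw [Finset.sum_comm, Finset.mul_sum, map_sum]
  refine Finset.sum_congr rfl fun s _ => ?_
  have hs : ∑ r, Matrix.single (s r) (s r) (1 : R) = 1 := by
    rw [Equiv.sum_comp s fun r => Matrix.single r r (1 : R), Matrix.sum_single_eq_diagonal,
      Matrix.diagonal_one]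
  rw [← Finset.smul_sum, hs]
  ext a b
  by_cases hab : a = b <;> simp [hab]

theorem formanek_units_conj {A : Type*} [Ring A] {N : ℕ} (u : Aˣ) (x : A) (y : Fin (N + 1) → A) :
    formanek (u * x * ↑u⁻¹) (fun j => u * y j * ↑u⁻¹) = u * formanek x y * ↑u⁻¹ :=
  (map_formanek (MulSemiringAction.toRingHom (ConjAct Aˣ) A (ConjAct.toConjAct u)) x y).symm

/-! ### Diagonalization of the generic matrix -/

theorem exists_diagonal_of_separable_charpoly {K : Type*} [Field K] [IsAlgClosed K] {n : ℕ}
    (X : Matrix (Fin n) (Fin n) K) (hX : X.charpoly.Separable) :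
    ∃ (u : (Matrix (Fin n) (Fin n) K)ˣ) (l : Fin n → K),
      X = u * Matrix.diagonal l * (↑u⁻¹ : Matrix (Fin n) (Fin n) K) := by
  classical
  have hcard : X.charpoly.roots.toFinset.card = n := by
    rw [Multiset.toFinset_card_of_nodup (Polynomial.nodup_roots hX),
      ← (IsAlgClosed.splits X.charpoly).natDegree_eq_card_roots, X.charpoly_natDegree_eq_dim,
      Fintype.card_fin]
  set e := (Finset.equivFinOfCardEq hcard).symm
  have hv (i : Fin n) : ∃ v : Fin n → K, v ≠ 0 ∧ X.mulVec v = (e i : K) • v := by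
    have h : X.charpoly.IsRoot (e i) := by
      have := (e i).2
      rw [Multiset.mem_toFinset] at this
      exact Polynomial.isRoot_of_mem_roots this
    rw [Polynomial.IsRoot, Matrix.eval_charpoly] at h
    obtain ⟨v, hv, h⟩ := Matrix.exists_mulVec_eq_zero_iff.2 h
    refine ⟨v, hv, ?_⟩
    rw [Matrix.sub_mulVec, sub_eq_zero] at h
    rw [← h]
    simp [Matrix.scalar_apply, ← Matrix.smul_one_eq_diagonal, Matrix.smul_mulVec]
  choose v hv0 hv using hv
  have hlin : LinearIndependent K v :=
    Module.End.eigenvectors_linearIndependent' X.mulVecLin (fun i => (e i : K))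
      (Subtype.val_injective.comp e.injective) v fun i =>
        ⟨Module.End.mem_eigenspace_iff.2 (hv i), hv0 i⟩
  have hu : IsUnit (Matrix.of v).transpose :=
    Matrix.linearIndependent_cols_iff_isUnit.1 hlin
  refine ⟨hu.unit, fun i => e i, ?_⟩
  rw [Units.eq_mul_inv_iff_mul_eq]
  ext i j
  rw [IsUnit.unit_spec, Matrix.mul_diagonal]
  simpa [Matrix.mul_apply, Matrix.mulVec, dotProduct, mul_comm] using
    congrFun (hv j) i

theorem units_conj_scalar {R : Type*} [CommRing R] {n : ℕ} (u : (Matrix (Fin n) (Fin n) R)ˣ)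
    (c : R) : u * Matrix.scalar (Fin n) c * (↑u⁻¹ : Matrix (Fin n) (Fin n) R) =
      Matrix.scalar (Fin n) c := by
  rw [← Matrix.scalar_comm _ (Commute.all _), mul_assoc, Units.mul_inv, mul_one]

theorem formanek_mem_range_scalar_of_separable {K : Type*} [Field K] [IsAlgClosed K] {N : ℕ}
    (X : Matrix (Fin (N + 1)) (Fin (N + 1)) K) (hX : X.charpoly.Separable)
    (y : Fin (N + 1) → Matrix (Fin (N + 1)) (Fin (N + 1)) K) :
    formanek X y ∈ Set.range (Matrix.scalar (Fin (N + 1))) := by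
  obtain ⟨u, l, rfl⟩ := exists_diagonal_of_separable_charpoly X hX
  have hy : y = fun j => u.val * (u⁻¹.val * y j * u.val) * u⁻¹.val := by
    funext j
    simp [mul_assoc]
  rw [hy, formanek_units_conj, formanek_diagonal, units_conj_scalar]
  exact ⟨_, rfl⟩

theorem separable_charpoly_map_iff {R F : Type*} [CommRing R] [Field F] [CharZero F] {n : ℕ}
    (M : Matrix (Fin n) (Fin n) R) (g : R →+* F) :
    (M.map g).charpoly.Separable ↔
      g (Polynomial.resultant M.charpoly M.charpoly.derivative n (n - 1)) ≠ 0 := by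
  have h1 : (M.map g).charpoly.natDegree = n := by simp [Matrix.charpoly_natDegree_eq_dim]
  have h2 : (M.map g).charpoly.derivative.natDegree = n - 1 := by
    rw [Polynomial.natDegree_derivative, h1]
  have h3 := Polynomial.resultant_eq_zero_iff (f := (M.map g).charpoly)
    (g := (M.map g).charpoly.derivative)
  rw [h1, h2, Matrix.charpoly_map, Polynomial.derivative_map, Polynomial.resultant_map_map,
    ← Polynomial.derivative_map, ← Matrix.charpoly_map] at h3
  rw [Ne, h3, not_and_not_right, Polynomial.Separable]
  exact ⟨fun h _ => h, fun h => h (Or.inl (Matrix.charpoly_monic _).ne_zero)⟩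

/-- The evaluation of polynomials in the entries of the generic matrices at a tuple of matrices. -/
noncomputable def evalTuple {k : Type*} [Field k] {m n : ℕ}
    (a : Fin m → Matrix (Fin n) (Fin n) k) : GenericEntryRing k m n →ₐ[k] k :=
  MvPolynomial.aeval fun q => a q.1 q.2.1 q.2.2

theorem genericMatrix_map_evalTuple {k : Type*} [Field k] {m n : ℕ}
    (a : Fin m → Matrix (Fin n) (Fin n) k) (l : Fin m) :
    (evalTuple a).mapMatrix (genericMatrix k m n l) = a l := by
  ext i j
  simp [genericMatrix, evalTuple]

/-- Over any field containing the polynomial ring, the generic matrix has separable characteristic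
polynomial: its discriminant does not vanish, as it does not vanish at a diagonal matrix with
distinct entries. -/
theorem separable_charpoly_genericMatrix {k : Type*} [Field k] [CharZero k] {m n : ℕ} (l : Fin m)
    {K : Type*} [Field K] (f : GenericEntryRing k m n →+* K) (hf : Function.Injective f) :
    ((genericMatrix k m n l).map f).charpoly.Separable := by
  have : CharZero K := charZero_of_injective_ringHom (f := f.comp MvPolynomial.C)
    (hf.comp (MvPolynomial.C_injective _ _))
  rw [separable_charpoly_map_iff, Ne, map_eq_zero_iff f hf]
  intro h
  let a : Fin m → Matrix (Fin n) (Fin n) k := fun _ => Matrix.diagonal fun i => ((i : ℕ) : k)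
  refine (separable_charpoly_map_iff (genericMatrix k m n l) (evalTuple a).toRingHom).1 ?_
    (by rw [h, map_zero])
  have ha : (genericMatrix k m n l).map (evalTuple a).toRingHom = a l :=
    genericMatrix_map_evalTuple a l
  rw [ha, Matrix.charpoly_diagonal, Polynomial.separable_prod_X_sub_C_iff]
  exact Nat.cast_injective.comp Fin.val_injective

/-- Formanek's polynomial is central: its value at a generic matrix is a scalar matrix. -/
theorem formanek_genericMatrix_mem_range_scalar {k : Type*} [Field k] [CharZero k] {m N : ℕ}
    (l : Fin m)
    (y : Fin (N + 1) → Matrix (Fin (N + 1)) (Fin (N + 1)) (GenericEntryRing k m (N + 1))) :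
    formanek (genericMatrix k m (N + 1) l) y ∈ Set.range (Matrix.scalar (Fin (N + 1))) := by
  let L := AlgebraicClosure (FractionRing (GenericEntryRing k m (N + 1)))
  let f : GenericEntryRing k m (N + 1) →+* L :=
    (algebraMap (FractionRing (GenericEntryRing k m (N + 1))) L).comp (algebraMap _ _)
  have hf : Function.Injective f :=
    (algebraMap (FractionRing (GenericEntryRing k m (N + 1))) L).injective.comp
      (IsFractionRing.injective _ _)
  obtain ⟨c, hc⟩ := formanek_mem_range_scalar_of_separable _
    (separable_charpoly_genericMatrix l f hf) fun j => (y j).map f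
  have h : (formanek (genericMatrix k m (N + 1) l) y).map f = Matrix.scalar _ c := by
    rw [hc]
    exact map_formanek f.mapMatrix _ _
  refine ⟨formanek (genericMatrix k m (N + 1) l) y 0 0, ?_⟩
  ext1 i j
  apply hf
  have hij := congrFun (congrFun h i) j
  have h00 := congrFun (congrFun h 0) 0
  simp only [Matrix.map_apply, Matrix.scalar_apply, Matrix.diagonal_apply, if_true] at hij h00 ⊢
  rw [hij]
  split_ifs
  · exact h00
  · exact map_zero f

/-! ### Pairs of matrices with scalar commutant -/

/-- The determinant of the `n² × n²` matrix whose rows are the entries of `A ^ i * B * A ^ j`. If it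
is invertible, these words span the space of all matrices. -/
def spanDet {R : Type*} [CommRing R] {n : ℕ} (A B : Matrix (Fin n) (Fin n) R) : R :=
  (Matrix.of fun p q : Fin n × Fin n => (A ^ (p.1 : ℕ) * B * A ^ (p.2 : ℕ)) q.1 q.2).det

theorem map_spanDet {R S : Type*} [CommRing R] [CommRing S] (f : R →+* S) {n : ℕ}
    (A B : Matrix (Fin n) (Fin n) R) : f (spanDet A B) = spanDet (A.map f) (B.map f) := by
  rw [spanDet, spanDet, RingHom.map_det]
  congr 1
  ext p q
  rw [← RingHom.mapMatrix_apply f A, ← RingHom.mapMatrix_apply f B, Matrix.of_apply, ← map_pow,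
    ← map_pow, ← map_mul, ← map_mul]
  rfl

theorem mem_range_scalar_of_spanDet_ne_zero {R : Type*} [CommRing R] [IsDomain R] {n : ℕ}
    {A B Z : Matrix (Fin n) (Fin n) R} (h : spanDet A B ≠ 0) (hA : Commute A Z)
    (hB : Commute B Z) : Z ∈ Set.range (Matrix.scalar (Fin n)) := by
  set M : Matrix (Fin n × Fin n) (Fin n × Fin n) R :=
    Matrix.of fun p q => (A ^ (p.1 : ℕ) * B * A ^ (p.2 : ℕ)) q.1 q.2 with hM
  -- multiplying by the adjugate expresses a multiple of each matrix unit through the words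
  have hsum (i j : Fin n) : ∑ p : Fin n × Fin n,
      M.adjugate (i, j) p • (A ^ (p.1 : ℕ) * B * A ^ (p.2 : ℕ)) =
        spanDet A B • Matrix.single i j 1 := by
    ext r s
    have h1 := congrFun (congrFun M.adjugate_mul (i, j)) (r, s)
    rw [Matrix.mul_apply] at h1
    rw [Matrix.sum_apply]
    refine h1.trans ?_
    simp [Matrix.one_apply, Matrix.single_apply, spanDet, hM]
  refine Matrix.mem_range_scalar_iff_commute_single'.2 fun i j => ?_
  have hc : Commute (spanDet A B • Matrix.single i j (1 : R)) Z := by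
    rw [← hsum]
    exact Commute.sum_left _ _ _ fun p _ =>
      (((hA.pow_left _).mul_left hB).mul_left (hA.pow_left _)).smul_left _
  refine smul_right_injective _ h ?_
  change _ • (_ * _) = _ • (_ * _)
  rw [← smul_mul_assoc, ← mul_smul_comm]
  exact hc

theorem spanDet_diagonal_ne_zero {R : Type*} [CommRing R] [IsDomain R] {n : ℕ} {l : Fin n → R}
    (hl : Function.Injective l) :
    spanDet (Matrix.diagonal l) (Matrix.of fun _ _ => (1 : R)) ≠ 0 := by
  have h : (Matrix.of fun p q : Fin n × Fin n => (Matrix.diagonal l ^ (p.1 : ℕ) *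
      (Matrix.of fun _ _ => 1 : Matrix (Fin n) (Fin n) R) * Matrix.diagonal l ^ (p.2 : ℕ)) q.1 q.2) =
      Matrix.kroneckerMap (· * ·) (Matrix.vandermonde l).transpose
        (Matrix.vandermonde l).transpose := by
    ext p q
    simp [Matrix.diagonal_pow, Matrix.mul_diagonal, Matrix.diagonal_mul, Matrix.vandermonde_apply,
      Matrix.kroneckerMap_apply]
  rw [spanDet, h, Matrix.det_kronecker, Matrix.det_transpose]
  have := Matrix.det_vandermonde_ne_zero_iff.2 hl
  exact mul_ne_zero (pow_ne_zero _ this) (pow_ne_zero _ this)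

/-- The elements `0, 1, …, n - 1` of `k`. -/
def natNodes (k : Type*) [Field k] (n : ℕ) (i : Fin n) : k := (i : ℕ)

theorem natNodes_injective (k : Type*) [Field k] [CharZero k] (n : ℕ) :
    Function.Injective (natNodes k n) :=
  Nat.cast_injective.comp Fin.val_injective

/-- The polynomial `spanDet X₀ X₁` in the entries of the generic matrices. -/
noncomputable def genericSpanDet (k : Type*) [Field k] (M n : ℕ) :
    GenericEntryRing k (M + 2) n :=
  spanDet (genericMatrix k (M + 2) n 0) (genericMatrix k (M + 2) n 1)

theorem evalTuple_genericSpanDet {k : Type*} [Field k] {M n : ℕ}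
    (a : Fin (M + 2) → Matrix (Fin n) (Fin n) k) :
    evalTuple a (genericSpanDet k M n) = spanDet (a 0) (a 1) := by
  have h := map_spanDet (evalTuple a).toRingHom (genericMatrix k (M + 2) n 0)
    (genericMatrix k (M + 2) n 1)
  have h0 := genericMatrix_map_evalTuple a 0
  have h1 := genericMatrix_map_evalTuple a 1
  rw [← h0, ← h1]
  exact h

theorem genericSpanDet_ne_zero (k : Type*) [Field k] [CharZero k] (M n : ℕ) :
    genericSpanDet k M n ≠ 0 := by
  intro h
  have h1 := evalTuple_genericSpanDet fun l : Fin (M + 2) =>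
    if l = 0 then Matrix.diagonal (natNodes k n) else Matrix.of fun _ _ => 1
  rw [h, map_zero] at h1
  exact spanDet_diagonal_ne_zero (natNodes_injective k n) h1.symm

/-! ### A central element which is not symmetric -/

/-- The tuple `y` with `y₀ = e₀(x₀) x₁` and `yⱼ = eⱼ(x₀) x_last` for `j ≠ 0`, where the `eⱼ` are the
Lagrange polynomials at the nodes `0, 1, …`. -/
noncomputable def lagrangeTuple (k : Type*) [Field k] {A : Type*} [Ring A] [Algebra k A] {M : ℕ}
    (N : ℕ) (x : Fin (M + 2) → A) (j : Fin (N + 2)) : A :=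
  Polynomial.aeval (x 0)
    (Lagrange.basis Finset.univ (natNodes k (N + 2)) j) *
      x (if j = 0 then 1 else Fin.last _)

/-- Formanek's polynomial evaluated at `x₀` and the tuple `lagrangeTuple`. -/
noncomputable def formanekLagrange (k : Type*) [Field k] {A : Type*} [Ring A] [Algebra k A] {M : ℕ}
    (N : ℕ) (x : Fin (M + 2) → A) : A :=
  formanek (x 0) (lagrangeTuple k N x)

theorem map_formanekLagrange {k : Type*} [Field k] {A B : Type*} [Ring A] [Algebra k A] [Ring B]
    [Algebra k B] (f : A →ₐ[k] B) {M N : ℕ} (x : Fin (M + 2) → A) :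
    f (formanekLagrange k N x) = formanekLagrange k N fun l => f (x l) := by
  simp only [formanekLagrange, map_formanek, map_mul, lagrangeTuple, ← Polynomial.aeval_algHom_apply]
  rfl

theorem lagrangeTuple_apply_of_diagonal {k : Type*} [Field k] [CharZero k] {M N : ℕ}
    (x : Fin (M + 2) → Matrix (Fin (N + 2)) (Fin (N + 2)) k)
    (hx : x 0 = Matrix.diagonal (natNodes k (N + 2))) (j r s : Fin (N + 2)) :
    lagrangeTuple k N x j r s = if r = j then x (if j = 0 then 1 else Fin.last _) r s else 0 := by
  have haeval (p : Polynomial k) (l : Fin (N + 2) → k) :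
      Polynomial.aeval (Matrix.diagonal l) p = Matrix.diagonal fun i => p.eval (l i) := by
    have h := Polynomial.aeval_algHom_apply (Matrix.diagonalAlgHom k) l p
    refine h.trans (congrArg Matrix.diagonal (funext fun i => ?_))
    have h' := Polynomial.aeval_algHom_apply (Pi.evalAlgHom k (fun _ : Fin (N + 2) => k) i) l p
    exact h'.symm
  have hinj : Set.InjOn (natNodes k (N + 2)) ↑(Finset.univ : Finset (Fin (N + 2))) :=
    (natNodes_injective k _).injOn
  rw [lagrangeTuple, hx, haeval, Matrix.diagonal_mul]
  by_cases h : r = j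
  · rw [if_pos h, h, Lagrange.eval_basis_self hinj (Finset.mem_univ _), one_mul]
  · rw [if_neg h, Lagrange.eval_basis_of_ne (Ne.symm h) (Finset.mem_univ _), zero_mul]

theorem formanekLagrange_of_diagonal {k : Type*} [Field k] [CharZero k] {M N : ℕ}
    (x : Fin (M + 2) → Matrix (Fin (N + 2)) (Fin (N + 2)) k)
    (hx : x 0 = Matrix.diagonal (natNodes k (N + 2))) :
    formanekLagrange k N x = Matrix.scalar (Fin (N + 2))
      ((Matrix.vandermonde (natNodes k (N + 2))).det ^ 2 *
        ∏ j : Fin (N + 2), x (if j = 0 then 1 else Fin.last _) j (j + 1)) := by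
  rw [formanekLagrange, hx, formanek_diagonal]
  -- the Lagrange polynomials annihilate all permutations but the identity
  congr 2
  rw [Fintype.sum_eq_single 1]
  · exact Finset.prod_congr rfl fun j _ => by
      simp [lagrangeTuple_apply_of_diagonal x hx]
  · intro s hs
    obtain ⟨j, hj⟩ : ∃ j, s j ≠ j := by
      by_contra! h
      exact hs (Equiv.ext h)
    refine Finset.prod_eq_zero (Finset.mem_univ j) ?_
    rw [lagrangeTuple_apply_of_diagonal x hx, if_neg hj]

/-- A tuple of matrices at which `formanekLagrange` distinguishes a tuple from its transpose: a
diagonal matrix in position `0`, the matrix of a cyclic permutation in the last position, and the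
matrix unit `E₀₁` elsewhere. -/
def asymmetricPoint (k : Type*) [Field k] (M N : ℕ) (l : Fin (M + 2)) :
    Matrix (Fin (N + 2)) (Fin (N + 2)) k :=
  if l = 0 then Matrix.diagonal (natNodes k (N + 2))
  else if l = Fin.last _ then Matrix.of fun i j => if j = i + 1 then 1 else 0
  else Matrix.single 0 1 1

theorem formanekLagrange_asymmetricPoint (k : Type*) [Field k] [CharZero k] (M N : ℕ) :
    formanekLagrange k N (asymmetricPoint k M N) = Matrix.scalar (Fin (N + 2))
      ((Matrix.vandermonde (natNodes k (N + 2))).det ^ 2) := by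
  rw [formanekLagrange_of_diagonal _ (by simp [asymmetricPoint]), Finset.prod_eq_one, mul_one]
  intro j _
  have h : Fin.last (M + 1) ≠ 0 := Fin.last_pos.ne'
  by_cases hj : j = 0
  · by_cases h1 : (1 : Fin (M + 2)) = Fin.last (M + 1) <;> simp [asymmetricPoint, hj, h1, h]
  · simp [asymmetricPoint, hj, h]

theorem formanekLagrange_asymmetricPoint_transpose (k : Type*) [Field k] [CharZero k] {M N : ℕ}
    (h : ¬ (M = 0 ∧ N = 0)) :
    formanekLagrange k N (fun l => (asymmetricPoint k M N l).transpose) = 0 := by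
  rw [formanekLagrange_of_diagonal _ (by simp [asymmetricPoint]),
    Finset.prod_eq_zero (Finset.mem_univ 0), mul_zero, map_zero]
  have h0 : Fin.last (M + 1) ≠ 0 := Fin.last_pos.ne'
  by_cases h1 : (1 : Fin (M + 2)) = Fin.last (M + 1)
  · have hM : M = 0 := by simpa [Fin.ext_iff] using h1.symm
    obtain ⟨N, rfl⟩ := Nat.exists_eq_succ_of_ne_zero fun hN => h ⟨hM, hN⟩
    have h2 : (0 : Fin (N + 1 + 2)) ≠ 1 + 1 := by
      rw [Ne, Fin.ext_iff, Fin.val_add, Fin.val_one, Nat.mod_eq_of_lt (by omega)]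
      simp
    simp [asymmetricPoint, h1, h0, h2]
  · simp [asymmetricPoint, h1]

theorem transposeEntries_genericMatrix (k : Type*) [Field k] (m n : ℕ) (l : Fin m) :
    (transposeEntries k m n).mapMatrix (genericMatrix k m n l) =
      (genericMatrix k m n l).transpose := by
  ext1 i j
  simp [genericMatrix, transposeEntries]

theorem evalTuple_transposeEntries {k : Type*} [Field k] {m n : ℕ}
    (a : Fin m → Matrix (Fin n) (Fin n) k) (f : GenericEntryRing k m n) :
    evalTuple a (transposeEntries k m n f) = evalTuple (fun l => (a l).transpose) f := by
  simp only [evalTuple, transposeEntries, MvPolynomial.aeval_rename]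
  rfl

/-- The scalar polynomial which `formanekLagrange` takes as its value at the generic matrices,
read off from the entry in the upper left corner. -/
noncomputable def centralPolynomial (k : Type*) [Field k] (M N : ℕ) :
    GenericEntryRing k (M + 2) (N + 2) :=
  formanekLagrange k N (genericMatrix k (M + 2) (N + 2)) 0 0

theorem formanekLagrange_genericMatrix (k : Type*) [Field k] [CharZero k] (M N : ℕ) :
    formanekLagrange k N (genericMatrix k (M + 2) (N + 2)) =
      Matrix.scalar (Fin (N + 2)) (centralPolynomial k M N) := by
  obtain ⟨f, hf⟩ := formanek_genericMatrix_mem_range_scalar (k := k) (0 : Fin (M + 2))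
    (lagrangeTuple k N (genericMatrix k (M + 2) (N + 2)))
  rw [centralPolynomial, formanekLagrange, ← hf]
  simp

theorem formanekLagrange_eq_scalar_evalTuple {k : Type*} [Field k] [CharZero k] {M N : ℕ}
    (a : Fin (M + 2) → Matrix (Fin (N + 2)) (Fin (N + 2)) k) :
    formanekLagrange k N a =
      Matrix.scalar (Fin (N + 2)) (evalTuple a (centralPolynomial k M N)) := by
  have h := map_formanekLagrange (N := N) (evalTuple a).mapMatrix
    (genericMatrix k (M + 2) (N + 2))
  simp only [genericMatrix_map_evalTuple] at h
  rw [← h, formanekLagrange_genericMatrix]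
  ext1 i j
  by_cases hij : i = j <;> simp [hij]

/-- Unless there are two generic matrices of size two, the central polynomial is not invariant under
transposing all generic matrices. -/
theorem transposeEntries_centralPolynomial_ne (k : Type*) [Field k] [CharZero k] {M N : ℕ}
    (h : ¬ (M = 0 ∧ N = 0)) :
    transposeEntries k (M + 2) (N + 2) (centralPolynomial k M N) ≠ centralPolynomial k M N := by
  intro heq
  have h1 := formanekLagrange_asymmetricPoint k M N
  have h2 := formanekLagrange_asymmetricPoint_transpose k h
  rw [formanekLagrange_eq_scalar_evalTuple] at h1 h2
  rw [← evalTuple_transposeEntries, heq, h1, ← map_zero (Matrix.scalar _),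
    Matrix.scalar_inj] at h2
  exact pow_ne_zero 2 (Matrix.det_vandermonde_ne_zero_iff.2 (natNodes_injective k _)) h2

/-! ### The universal division algebra -/

theorem rhoGeneric_val_of_scalar {k : Type*} [Field k] {m n : ℕ} {p : genericMatrixRing k m n}
    {f : GenericEntryRing k m n} (hp : p.val = Matrix.scalar (Fin n) f) :
    ((rhoGeneric k m n).toLinearMap p).val = Matrix.scalar (Fin n) (transposeEntries k m n f) := by
  change rhoMatrix k m n p.val = _
  rw [hp]
  ext1 i j
  simp only [rhoMatrix, LinearMap.coe_mk, AddHom.coe_mk, Matrix.transpose_apply,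
    Matrix.map_apply, Matrix.scalar_apply]
  by_cases h : i = j
  · simp [h]
  · simp [h, Ne.symm h]

/-- Central elements of the generic matrix ring are scalar matrices, since the first two generic
matrices already have scalar commutant. -/
theorem val_mem_range_scalar_of_mem_center {k : Type*} [Field k] [CharZero k] {M n : ℕ}
    {p : genericMatrixRing k (M + 2) n} (hp : p ∈ Set.center (genericMatrixRing k (M + 2) n)) :
    p.val ∈ Set.range (Matrix.scalar (Fin n)) := by
  have h (l : Fin (M + 2)) : Commute (genericMatrix k (M + 2) n l) p.val :=
    congrArg Subtype.val (Semigroup.mem_center_iff.1 hp (genX k (M + 2) n l))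
  exact mem_range_scalar_of_spanDet_ne_zero (genericSpanDet_ne_zero k M n) (h 0) (h 1)

theorem centralDenominators_le_nonZeroDivisorsLeft (k : Type*) [Field k] [CharZero k] (M n : ℕ) :
    centralDenominators k (M + 2) n ≤ nonZeroDivisorsLeft (genericMatrixRing k (M + 2) n) := by
  refine Submonoid.closure_le.2 fun s hs => ?_
  obtain ⟨f, hf⟩ := val_mem_range_scalar_of_mem_center hs.1
  have hf0 : f ≠ 0 := by
    rintro rfl
    exact hs.2 (Subtype.ext (by rw [← hf, map_zero]; rfl))
  rw [SetLike.mem_coe, mem_nonZeroDivisorsLeft_iff]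
  intro x hx
  have h : s.val * x.val = 0 := congrArg Subtype.val hx
  rw [← hf, Matrix.scalar_apply, ← Matrix.smul_eq_diagonal_mul] at h
  exact Subtype.ext (smul_right_injective _ hf0 (h.trans (smul_zero f).symm))

theorem toUD_injective (k : Type*) [Field k] [CharZero k] (M n : ℕ) :
    Function.Injective (toUD k (M + 2) n) :=
  OreLocalization.numeratorHom_inj (centralDenominators_le_nonZeroDivisorsLeft k M n)

theorem toUD_mem_center {k : Type*} [Field k] {m n : ℕ} {p : genericMatrixRing k m n}
    (hp : p ∈ Set.center (genericMatrixRing k m n)) :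
    toUD k m n p ∈ Subalgebra.center k (UniversalDivisionAlgebra k m n) := by
  rw [Subalgebra.mem_center_iff]
  have h1 (r : genericMatrixRing k m n) : Commute (toUD k m n r) (toUD k m n p) := by
    have := Semigroup.mem_center_iff.1 hp r
    exact Commute.map this (toUD k m n)
  intro x
  induction x using OreLocalization.ind with
  | _ r s =>
    have hx : toUD k m n s * (OreLocalization.oreDiv r s) = toUD k m n r :=
      OreLocalization.mul_cancel
    apply (isUnit_toUD k m n s).mul_left_cancel
    rw [← mul_assoc, hx, (h1 r).eq, ← mul_assoc, (h1 s).eq, mul_assoc, hx]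

theorem rhoUD_isFirstKind_iff (k : Type*) [Field k] {m n : ℕ}
    (hinj : Function.Injective (toUD k m n)) :
    (rhoUD k m n).IsFirstKind ↔
      ∀ p ∈ Set.center (genericMatrixRing k m n),
        (rhoGeneric k m n).toLinearMap p = p := by
  constructor
  · intro h p hp
    apply hinj
    rw [← rhoUD_toUD]
    exact h _ (toUD_mem_center hp)
  · intro h x hx
    rw [Subalgebra.mem_center_iff] at hx
    induction x using OreLocalization.ind with
    | _ r s =>
      set x : UniversalDivisionAlgebra k m n := OreLocalization.oreDiv r s
      have hxr : toUD k m n s * x = toUD k m n r := OreLocalization.mul_cancel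
      have hs : (s : genericMatrixRing k m n) ∈
          Set.center (genericMatrixRing k m n) :=
        Semigroup.mem_center_iff.2 fun g => (centralDenominators_comm k m n s g).symm
      have hr : r ∈ Set.center (genericMatrixRing k m n) := by
        refine Semigroup.mem_center_iff.2 fun g => hinj ?_
        have hsU := Subalgebra.mem_center_iff.1 (toUD_mem_center hs) (toUD k m n g)
        rw [map_mul, map_mul, ← hxr, ← mul_assoc, hsU, mul_assoc, hx, mul_assoc]
      have h1 : (rhoUD k m n).toLinearMap (toUD k m n s * x) =
          (rhoUD k m n).toLinearMap x *
            (rhoUD k m n).toLinearMap (toUD k m n s) :=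
        (rhoUD k m n).map_mul_rev' _ _
      rw [hxr, rhoUD_toUD, rhoUD_toUD, h r hr, h s hs, ← hxr] at h1
      exact (isUnit_toUD k m n s).mul_right_cancel (h1.symm.trans (hx _))

theorem not_isFirstKind_rhoUD (k : Type*) [Field k] [CharZero k] {m n M N : ℕ}
    (hm : m = M + 2) (hn : n = N + 2) (h : ¬ (M = 0 ∧ N = 0)) :
    ¬ (rhoUD k m n).IsFirstKind := by
  subst hm hn
  rw [rhoUD_isFirstKind_iff k (toUD_injective k M (N + 2))]
  intro hfix
  -- the central polynomial lies in the generic matrix ring, being a noncommutative polynomial in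
  -- the generic matrices
  set p := formanekLagrange k N (genX k (M + 2) (N + 2)) with hp
  have hval : p.val = Matrix.scalar (Fin (N + 2)) (centralPolynomial k M N) :=
    (map_formanekLagrange (genericMatrixRing k (M + 2) (N + 2)).val _).trans
      (formanekLagrange_genericMatrix k M N)
  have hc : p ∈ Set.center (genericMatrixRing k (M + 2) (N + 2)) :=
    Semigroup.mem_center_iff.2 fun g => Subtype.ext (by
      change g.val * p.val = p.val * g.val
      rw [hval, Matrix.scalar_comm _ (Commute.all _)])
  have h1 := rhoGeneric_val_of_scalar hval
  rw [hfix p hc, hval, Matrix.scalar_inj] at h1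
  exact transposeEntries_centralPolynomial_ne k h h1.symm

/-! ### Pairs of `2 × 2` matrices -/

/-- For `2 × 2` matrices `A` and `B`, this is `J * [A, B]` with `J` the standard skew-symmetric
matrix. It intertwines `A` with `Aᵀ` and `B` with `Bᵀ`. -/
def transposeIntertwiner {R : Type*} [CommRing R] (A B : Matrix (Fin 2) (Fin 2) R) :
    Matrix (Fin 2) (Fin 2) R :=
  !![0, 1; -1, 0] * (A * B - B * A)

theorem transposeIntertwiner_mul_left {R : Type*} [CommRing R] (A B : Matrix (Fin 2) (Fin 2) R) :
    transposeIntertwiner A B * A = A.transpose * transposeIntertwiner A B := by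
  ext i j
  fin_cases i <;> fin_cases j <;>
    simp [transposeIntertwiner, Matrix.vecMul, dotProduct, Matrix.mul_apply,
      Fin.sum_univ_two] <;> ring

theorem transposeIntertwiner_mul_right {R : Type*} [CommRing R] (A B : Matrix (Fin 2) (Fin 2) R) :
    transposeIntertwiner A B * B = B.transpose * transposeIntertwiner A B := by
  ext i j
  fin_cases i <;> fin_cases j <;>
    simp [transposeIntertwiner, Matrix.vecMul, dotProduct, Matrix.mul_apply,
      Fin.sum_univ_two] <;> ring

theorem map_transposeIntertwiner {R S : Type*} [CommRing R] [CommRing S] (f : R →+* S)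
    (A B : Matrix (Fin 2) (Fin 2) R) :
    f.mapMatrix (transposeIntertwiner A B) =
      transposeIntertwiner (f.mapMatrix A) (f.mapMatrix B) := by
  rw [transposeIntertwiner, map_mul, map_sub, map_mul, map_mul, transposeIntertwiner]
  congr 1
  ext i j
  fin_cases i <;> fin_cases j <;> simp

theorem evalTuple_det_transposeIntertwiner {k : Type*} [Field k]
    (a : Fin 2 → Matrix (Fin 2) (Fin 2) k) :
    evalTuple a (transposeIntertwiner (genericMatrix k 2 2 0) (genericMatrix k 2 2 1)).det =
      (transposeIntertwiner (a 0) (a 1)).det := by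
  have h := map_transposeIntertwiner (evalTuple a).toRingHom (genericMatrix k 2 2 0)
    (genericMatrix k 2 2 1)
  have h0 : (evalTuple a).toRingHom.mapMatrix (genericMatrix k 2 2 0) = a 0 :=
    genericMatrix_map_evalTuple a 0
  have h1 : (evalTuple a).toRingHom.mapMatrix (genericMatrix k 2 2 1) = a 1 :=
    genericMatrix_map_evalTuple a 1
  rw [h0, h1] at h
  rw [← h]
  exact RingHom.map_det _ _

theorem det_transposeIntertwiner_genericMatrix_ne_zero (k : Type*) [Field k] :
    (transposeIntertwiner (genericMatrix k 2 2 0) (genericMatrix k 2 2 1)).det ≠ 0 := by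
  intro h
  have h1 := evalTuple_det_transposeIntertwiner (k := k) ![!![0, 1; 0, 0], !![0, 0; 1, 0]]
  rw [h, map_zero] at h1
  simp [transposeIntertwiner, Matrix.det_fin_two] at h1

/-- The intertwiner `g` satisfies `g p = ρ(p)ᵗ g` for all `p` in the generic matrix ring, so that
scalar elements are fixed by `ρ`. -/
theorem isFirstKind_rhoUD_two (k : Type*) [Field k] [CharZero k] :
    (rhoUD k 2 2).IsFirstKind := by
  rw [rhoUD_isFirstKind_iff k (toUD_injective k 0 2)]
  intro p hp
  set g := transposeIntertwiner (genericMatrix k 2 2 0) (genericMatrix k 2 2 1) with hg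
  have hint : ∀ A ∈ genericMatrixRing k 2 2, g * A = (transposeEntries k 2 2).mapMatrix A * g := by
    intro A hA
    unfold genericMatrixRing at hA
    induction hA using Algebra.adjoin_induction with
    | mem x hx =>
      obtain ⟨l, rfl⟩ := hx
      rw [transposeEntries_genericMatrix]
      match l with
      | 0 => exact transposeIntertwiner_mul_left _ _
      | 1 => exact transposeIntertwiner_mul_right _ _
    | algebraMap c => rw [AlgHom.commutes, Algebra.commutes]
    | add x y _ _ hx hy => rw [mul_add, hx, hy, map_add, add_mul]
    | mul x y _ _ hx hy => rw [← mul_assoc, hx, mul_assoc, hy, map_mul, mul_assoc]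
  obtain ⟨f, hf⟩ := val_mem_range_scalar_of_mem_center (M := 0) hp
  have hg0 : g ≠ 0 := by
    intro h
    apply det_transposeIntertwiner_genericMatrix_ne_zero k
    rw [← hg, h, Matrix.det_zero]
  have hfix : transposeEntries k 2 2 f = f := by
    have h := hint p.val p.2
    have hs : (transposeEntries k 2 2).mapMatrix (Matrix.scalar (Fin 2) f) =
        Matrix.scalar (Fin 2) (transposeEntries k 2 2 f) := by
      ext1 i j
      by_cases hij : i = j <;> simp [hij]
    rw [← hf, hs, ← Matrix.scalar_comm _ (Commute.all _), Matrix.scalar_apply, Matrix.scalar_apply,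
      ← Matrix.smul_eq_diagonal_mul, ← Matrix.smul_eq_diagonal_mul] at h
    exact (smul_left_injective _ hg0 h).symm
  apply Subtype.ext
  rw [rhoGeneric_val_of_scalar hf.symm, hfix, hf]

/-! ### Stabilizers -/

theorem mk_one_smul {k : Type*} [Field k] {m n : ℕ} (g : GL (Fin n) k)
    (x : Fin m → Matrix (Fin n) (Fin n) k) (l : Fin m) :
    ((⟨Matrix.ProjGenLinGroup.mk g, 1⟩ : PGLTau k n) • x) l =
      g.val * x l * (g⁻¹).val := rfl

theorem mk_ofAdd_one_smul {k : Type*} [Field k] {m n : ℕ} (g : GL (Fin n) k)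
    (x : Fin m → Matrix (Fin n) (Fin n) k) (l : Fin m) :
    ((⟨Matrix.ProjGenLinGroup.mk g, Multiplicative.ofAdd 1⟩ : PGLTau k n) • x) l =
      g.val * (x l).transpose * (g⁻¹).val := rfl

theorem isZariskiOpen_evalTuple_ne_zero {k : Type*} [Field k] {m n : ℕ}
    (f : GenericEntryRing k m n) :
    IsZariskiOpen {x : Fin m → Matrix (Fin n) (Fin n) k | evalTuple x f ≠ 0} := by
  refine ⟨Ideal.span {f}, fun x => ?_⟩
  rw [MvPolynomial.zeroLocus_span]
  simp [evalTuple]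

theorem exists_evalTuple_ne_zero {k : Type*} [Field k] [Infinite k] {m n : ℕ}
    {f : GenericEntryRing k m n} (hf : f ≠ 0) :
    ∃ x : Fin m → Matrix (Fin n) (Fin n) k, evalTuple x f ≠ 0 := by
  by_contra! h
  refine hf (MvPolynomial.funext fun y => ?_)
  have := h fun l => Matrix.of fun i j => y (l, i, j)
  rw [map_zero, ← this]
  rfl

theorem IsZariskiOpen.exists_evalTuple_ne_zero_subset {k : Type*} [Field k] {m n : ℕ}
    {U : Set (Fin m → Matrix (Fin n) (Fin n) k)} (hU : IsZariskiOpen U) (hne : U.Nonempty) :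
    ∃ f : GenericEntryRing k m n, f ≠ 0 ∧ ∀ x, evalTuple x f ≠ 0 → x ∈ U := by
  obtain ⟨I, hI⟩ := hU
  obtain ⟨x, hx⟩ := hne
  rw [hI, MvPolynomial.mem_zeroLocus_iff] at hx
  push Not at hx
  obtain ⟨f, hfI, hf⟩ := hx
  refine ⟨f, fun h => hf (by rw [h, map_zero]), fun y hy => ?_⟩
  rw [hI, MvPolynomial.mem_zeroLocus_iff]
  exact fun h => hy (h f hfI)

/-- The inverse of the intertwiner, followed by `τ`, stabilizes a general pair of `2 × 2`
matrices. -/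
theorem not_isGenericallyFree_two (k : Type*) [Field k] [Infinite k] :
    ¬ IsGenericallyFree (PGLTau k 2) k 2 2 := by
  rintro ⟨U, hU, hne, hstab⟩
  obtain ⟨f, hf, hfU⟩ := hU.exists_evalTuple_ne_zero_subset hne
  obtain ⟨x, hx⟩ := exists_evalTuple_ne_zero
    (mul_ne_zero hf (det_transposeIntertwiner_genericMatrix_ne_zero k))
  rw [map_mul, evalTuple_det_transposeIntertwiner] at hx
  let g : GL (Fin 2) k :=
    Matrix.GeneralLinearGroup.mkOfDetNeZero (transposeIntertwiner (x 0) (x 1))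
      (right_ne_zero_of_mul hx)
  have hmem : (⟨Matrix.ProjGenLinGroup.mk g⁻¹, Multiplicative.ofAdd 1⟩ : PGLTau k 2) ∈
      MulAction.stabilizer (PGLTau k 2) x := by
    rw [MulAction.mem_stabilizer_iff]
    funext l
    rw [mk_ofAdd_one_smul, inv_inv, mul_assoc, Units.inv_mul_eq_iff_eq_mul]
    symm
    match l with
    | 0 => exact transposeIntertwiner_mul_left _ _
    | 1 => exact transposeIntertwiner_mul_right _ _
  rw [hstab x (hfU x (left_ne_zero_of_mul hx)), Subgroup.mem_bot] at hmem
  have h1 : (Multiplicative.ofAdd 1 : Multiplicative (ZMod 2)) = 1 :=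
    congrArg SemidirectProduct.right hmem
  exact absurd h1 (by decide)

/-- It suffices to consider points with `spanDet X₀ X₁ ≠ 0`, which excludes nontrivial
elements of `PGLₙ`, and with different values of the central polynomial at the point and at its
transpose, which excludes the other coset. -/
theorem isGenericallyFree_of_ne (k : Type*) [Field k] [CharZero k] {m n M N : ℕ}
    (hm : m = M + 2) (hn : n = N + 2) (h : ¬ (M = 0 ∧ N = 0)) :
    IsGenericallyFree (PGLTau k n) k m n := by
  subst hm hn
  have hne := mul_ne_zero (genericSpanDet_ne_zero k M (N + 2))
    (sub_ne_zero.2 (transposeEntries_centralPolynomial_ne k h))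
  refine ⟨_, isZariskiOpen_evalTuple_ne_zero _, exists_evalTuple_ne_zero hne, fun x hx => ?_⟩
  rw [Set.mem_ofPred_eq, map_mul, evalTuple_genericSpanDet, map_sub, evalTuple_transposeEntries]
    at hx
  rw [Subgroup.eq_bot_iff_forall]
  rintro ⟨g, e⟩ hg
  rw [MulAction.mem_stabilizer_iff] at hg
  obtain ⟨g, rfl⟩ := Matrix.ProjGenLinGroup.mk_surjective g
  have he : ∀ e : Multiplicative (ZMod 2), e = 1 ∨ e = Multiplicative.ofAdd 1 := by decide
  rcases he e with rfl | rfl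
  · have hcomm (l : Fin (M + 2)) : Commute (x l) g.val := by
      have := congrFun hg l
      rw [mk_one_smul, Units.mul_inv_eq_iff_eq_mul] at this
      exact this.symm
    have hscal := mem_range_scalar_of_spanDet_ne_zero (left_ne_zero_of_mul hx) (hcomm 0) (hcomm 1)
    rw [← Matrix.GeneralLinearGroup.mem_center_iff_val_mem_range_scalar,
      ← Matrix.ProjGenLinGroup.mk_eq_one] at hscal
    rw [hscal]
    rfl
  · -- the central polynomial takes the same value at `x` and at its transpose
    refine absurd ?_ (right_ne_zero_of_mul hx)
    have hx' : x = fun l => (MulSemiringAction.toAlgHom k (Matrix (Fin (N + 2)) (Fin (N + 2)) k)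
        (ConjAct.toConjAct g)) (x l).transpose := by
      funext l
      exact (congrFun hg l).symm
    have h1 := map_formanekLagrange (N := N) (MulSemiringAction.toAlgHom k
      (Matrix (Fin (N + 2)) (Fin (N + 2)) k) (ConjAct.toConjAct g)) fun l => (x l).transpose
    rw [← hx', formanekLagrange_eq_scalar_evalTuple, formanekLagrange_eq_scalar_evalTuple] at h1
    have h2 := (units_conj_scalar g _).symm.trans h1
    rw [Matrix.scalar_inj] at h2
    rw [h2, sub_self]

theorem mainTheorem7 (k : Type*) [Field k] [IsAlgClosed k] [CharZero k] (m n : ℕ)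
    (hm : 2 ≤ m) (hn : 2 ≤ n) :
    ((rhoUD k m n).IsFirstKind ↔ (m = 2 ∧ n = 2)) ∧
      (IsGenericallyFree (PGLTau k n) k m n ↔ (m, n) ≠ (2, 2)) := by
  obtain ⟨M, hM⟩ := Nat.exists_eq_add_of_le' hm
  obtain ⟨N, hN⟩ := Nat.exists_eq_add_of_le' hn
  have hiff : (M = 0 ∧ N = 0) ↔ (m = 2 ∧ n = 2) := by omega
  rw [Ne, Prod.mk.injEq]
  by_cases h : m = 2 ∧ n = 2
  · obtain ⟨rfl, rfl⟩ := h
    simp [isFirstKind_rhoUD_two k, not_isGenericallyFree_two k]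
  · have h' := mt hiff.1 h
    exact ⟨iff_of_false (not_isFirstKind_rhoUD k hM hN h') h,
      iff_of_true (isGenericallyFree_of_ne k hM hN h') h⟩
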